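/- Let $k$ be a field, let $n\ge 2$ and $d\ge 1$ be integers, let $R=k[X_1,\dots,X_n]$ be the standard graded polynomial ring, and let $\mathfrak m=(X_1,\dots,X_n)$. For an $\mathbb N$-graded $R$-module $M$ put $\operatorname{end}(M)=\sup\{\mu : M_\mu\neq 0\}$, with $\operatorname{end}(0)=-\infty$. (1) If $f_0,\dots,f_n\in R$ are forms of degree $d$ (the zero form being allowed) such that the ideal $I=(f_0,\dots,f_n)$ is $\mathfrak m$-primary, then $$\operatorname{end}(R/I)\ \ge\ \left\lfloor\frac{(n+1)(d-1)}{2}\right\rfloor .$$ (2) If $k$ has characteristic $0$, then equality holds for sufficiently general forms: there is a nonempty Zariski open subset $U$ of the affine space over $k$ that parametrizes the coefficients of $(n+1)$-tuples of forms of degree $d$ in $X_1,\dots,X_n$, such that for every tuple $(f_0,\dots,f_n)$ with coefficients in $U$ the ideal $I=(f_0,\dots,f_n)$ is $\mathfrak m$-primary and $$\operatorname{end}(R/I)=\left\lfloor\frac{(n+1)(d-1)}{2}\right\rfloor .$$ -/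

import Mathlib

noncomputable section

/-- The end `sup {μ | M_μ ≠ 0}` of an `ℕ`-graded module with homogeneous components `ℳ μ`.
It is `⊥` (that is, `-∞`) for the zero module, and `⊤` (that is, `+∞`) if there are nonzero
components in arbitrarily large degrees. -/
def gradedEnd {k M : Type*} [Semiring k] [AddCommMonoid M] [Module k M]
    (ℳ : ℕ → Submodule k M) : WithBot ℕ∞ :=
  sSup ((fun μ : ℕ => ((μ : ℕ∞) : WithBot ℕ∞)) '' {μ : ℕ | ℳ μ ≠ ⊥})

/-- The homogeneous component `(R/I)_μ` of the quotient of the standard graded polynomial ring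
`R = k[X_1, …, X_n]` by an ideal `I`: the image of `R_μ`. -/
def quotientComponent {k : Type*} [Field k] {n : ℕ} (I : Ideal (MvPolynomial (Fin n) k)) (μ : ℕ) :
    Submodule k (MvPolynomial (Fin n) k ⧸ I) :=
  (MvPolynomial.homogeneousSubmodule (Fin n) k μ).map (Ideal.Quotient.mkₐ k I).toLinearMap

/-- `I` is `𝔪`-primary for `𝔪 = (X_1, …, X_n)`: it is a primary ideal with radical `𝔪`. -/
def IsIrrelevantPrimary {k : Type*} [Field k] {n : ℕ} (I : Ideal (MvPolynomial (Fin n) k)) : Prop :=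
  I.IsPrimary ∧ I.radical = MvPolynomial.idealOfVars (Fin n) k

/-- A subset of the affine space `k^σ` is Zariski open if its complement is the set of common
zeros of an ideal of polynomials. -/
def IsZariskiOpen {k σ : Type*} [Field k] (U : Set (σ → k)) : Prop :=
  ∃ J : Ideal (MvPolynomial σ k), U = (MvPolynomial.zeroLocus k J)ᶜ

/-- Indices for the coefficients of `n + 1` forms of degree `d` in `n` variables: the index of
the form together with an exponent vector of degree `d`. -/
abbrev FormCoeffIndex (n d : ℕ) : Type :=
  Fin (n + 1) × {α : Fin n →₀ ℕ // α.degree = d}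

/-- The point of affine space given by the degree `d` coefficients of `n + 1` polynomials. -/
def formCoeffs {k : Type*} [Field k] {n : ℕ} (d : ℕ) (f : Fin (n + 1) → MvPolynomial (Fin n) k) :
    FormCoeffIndex n d → k :=
  fun p => (f p.1).coeff p.2.1

end

/-! ### Ranks in pencils of matrices -/

section LinearAlgebra

open Polynomial

/-! Lower bound. Let `g = (0, X_1^d, …, X_n^d)` and suppose `I` contains all forms of degree `i`, so
that the first Koszul differential of `f` is onto in degree `i`. Join `g` to `f` by the pencil `(1 -
X) g + X f`. Its two Koszul differentials compose to zero over `k(X)`, and specialization can only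
lower ranks. Thus the rank of the first differential at `f` plus the rank of the second at `g` is at
most the dimension of the middle term (`finrank_range_add_finrank_range_le`). With `A = R/(X_1^d, …,
X_n^d)`, the cokernel of the second differential of `g` has dimension at most `dim A_{i-d} + dim R_i
- dim A_i` in degree `i`. Surjectivity therefore forces `dim A_i ≤ dim A_{i-d}`. But the Hilbert
function of `A`, the coefficients of `(1 + t + ⋯ + t^(d-1))^n`, is symmetric and strictly unimodal
enough that `dim A_{i-d} < dim A_i` whenever `0 ≤ 2i ≤ (n+1)(d-1)` (`boxCoeff_sub_lt`).

Upper bound. Containing every monomial of a fixed degree `t` is a Zariski open condition on the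
coefficients, so one example suffices: `(X_1 + ⋯ + X_n)^d, X_1^d, …, X_n^d`. Here the claim is that
multiplication by the `d`-th power of `X_1 + ⋯ + X_n` maps onto `A_i` once `2i > (n+1)(d-1)`. Over
`ℚ` this follows from an `𝔰𝔩₂` action with an invariant positive form (`mem_span_sum_X_pow_X_pow`);
it is then transported to `k`. -/

theorem Matrix.exists_mul_mul_eq_one_of_rank {K m n : Type*} [Field K] [Fintype m] [Fintype n]
    [DecidableEq m] [DecidableEq n] (M : Matrix m n K) :
    ∃ (P : Matrix (Fin M.rank) m K) (Q : Matrix n (Fin M.rank) K), P * M * Q = 1 := by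
  let b := Module.finBasis K (LinearMap.range M.mulVecLin)
  choose q hq using fun j => (b j).2
  have hli : LinearIndependent K fun j => M.mulVecLin (q j) := by
    have := b.linearIndependent.map' (LinearMap.range M.mulVecLin).subtype (Submodule.ker_subtype _)
    simpa only [Function.comp_def, Submodule.subtype_apply, ← hq] using this
  let Q : Matrix n (Fin M.rank) K := Matrix.of fun i j => q j i
  have hMQ : ∀ v, (M * Q).mulVec v = ∑ j, v j • M.mulVecLin (q j) := by
    intro v
    ext i
    simp only [Matrix.mulVec, dotProduct, Matrix.mul_apply, Q, Matrix.of_apply, Finset.sum_apply,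
      Pi.smul_apply, Matrix.mulVecLin_apply, smul_eq_mul]
    exact Finset.sum_congr rfl fun j _ => mul_comm _ _
  have hker : LinearMap.ker (M * Q).mulVecLin = ⊥ := by
    rw [LinearMap.ker_eq_bot']
    intro v hv
    rw [Matrix.mulVecLin_apply, hMQ] at hv
    exact funext (Fintype.linearIndependent_iff.1 hli v hv)
  obtain ⟨g, hg⟩ := (M * Q).mulVecLin.exists_leftInverse_of_injective hker
  refine ⟨LinearMap.toMatrix' g, Q, ?_⟩
  have := congrArg LinearMap.toMatrix' hg
  rw [LinearMap.toMatrix'_comp, LinearMap.toMatrix'_id] at this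
  rw [Matrix.mul_assoc, ← this]
  congr 1
  exact (LinearMap.toMatrix'_toLin' (M * Q)).symm

/-- Semicontinuity of rank: an invertible compression of the specialized matrix lifts to one over
`k[X]` whose determinant is nonzero at `a`, hence nonzero in `k(X)`. -/
theorem Matrix.rank_map_eval_le {k m n : Type*} [Field k] [Fintype m] [Fintype n]
    [DecidableEq m] [DecidableEq n] (M : Matrix m n k[X]) (a : k) :
    (M.map (evalRingHom a)).rank ≤ (M.map (algebraMap k[X] (FractionRing k[X]))).rank := by
  set φ := evalRingHom a
  set ι := algebraMap k[X] (FractionRing k[X])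
  obtain ⟨P, Q, h⟩ := Matrix.exists_mul_mul_eq_one_of_rank (M.map φ)
  let D := P.map C * M * Q.map C
  have hφ : D.map φ = 1 := by
    rw [← h]
    simp only [D, Matrix.map_mul]
    congr 2
    · ext i j; exact eval_C
    · ext i j; exact eval_C
  have hdet : D.det ≠ 0 := by
    intro h0
    have := congrArg φ h0
    rw [RingHom.map_det, RingHom.mapMatrix_apply, hφ, Matrix.det_one, map_zero] at this
    exact one_ne_zero this
  have hu : IsUnit (D.map ι) := by
    rw [Matrix.isUnit_iff_isUnit_det, ← RingHom.mapMatrix_apply, ← RingHom.map_det,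
      isUnit_iff_ne_zero]
    simpa [ι] using hdet
  have hr := Matrix.rank_of_isUnit _ hu
  rw [Fintype.card_fin] at hr
  rw [← hr]
  simp only [D, Matrix.map_mul]
  exact (Matrix.rank_mul_le_left _ _).trans (Matrix.rank_mul_le_right _ _)

/-- Two pencils of linear maps that compose to zero: the ranks at two different members of the
pencils are jointly bounded as they are for a single member. -/
theorem finrank_range_add_finrank_range_le {k V₁ V₂ V₃ : Type*} [Field k]
    [AddCommGroup V₁] [Module k V₁] [FiniteDimensional k V₁]
    [AddCommGroup V₂] [Module k V₂] [FiniteDimensional k V₂]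
    [AddCommGroup V₃] [Module k V₃] [FiniteDimensional k V₃]
    (A₀ A₁ : V₂ →ₗ[k] V₃) (B₀ B₁ : V₁ →ₗ[k] V₂)
    (h₀ : A₀ ∘ₗ B₀ = 0) (h₁ : A₁ ∘ₗ B₁ = 0) (h₀₁ : A₀ ∘ₗ B₁ + A₁ ∘ₗ B₀ = 0) :
    Module.finrank k (LinearMap.range A₁) + Module.finrank k (LinearMap.range B₀) ≤
      Module.finrank k V₂ := by
  classical
  let b₁ := Module.finBasis k V₁
  let b₂ := Module.finBasis k V₂
  let b₃ := Module.finBasis k V₃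
  let pencil : ∀ {r s : ℕ}, Matrix (Fin r) (Fin s) k → Matrix (Fin r) (Fin s) k →
      Matrix (Fin r) (Fin s) k[X] := fun S T => (1 - X : k[X]) • S.map C + (X : k[X]) • T.map C
  have hp0 : ∀ {r s : ℕ} (S T : Matrix (Fin r) (Fin s) k),
      (pencil S T).map (evalRingHom 0) = S := by
    intro r s S T; ext i j; simp [pencil, Matrix.map_apply]
  have hp1 : ∀ {r s : ℕ} (S T : Matrix (Fin r) (Fin s) k),
      (pencil S T).map (evalRingHom 1) = T := by
    intro r s S T; ext i j; simp [pencil, Matrix.map_apply]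
  let a₀ := LinearMap.toMatrix b₂ b₃ A₀
  let a₁ := LinearMap.toMatrix b₂ b₃ A₁
  let β₀ := LinearMap.toMatrix b₁ b₂ B₀
  let β₁ := LinearMap.toMatrix b₁ b₂ B₁
  have e₀ : a₀ * β₀ = 0 := by rw [← LinearMap.toMatrix_comp, h₀, map_zero]
  have e₁ : a₁ * β₁ = 0 := by rw [← LinearMap.toMatrix_comp, h₁, map_zero]
  have e₀₁ : a₀ * β₁ + a₁ * β₀ = 0 := by
    rw [← LinearMap.toMatrix_comp, ← LinearMap.toMatrix_comp, ← map_add, h₀₁, map_zero]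
  have hmul : pencil a₀ a₁ * pencil β₀ β₁ = 0 := by
    have e₀₁' : a₁ * β₀ = -(a₀ * β₁) := by rw [eq_neg_iff_add_eq_zero, add_comm, e₀₁]
    simp only [pencil, Matrix.add_mul, Matrix.mul_add, Matrix.smul_mul, Matrix.mul_smul, ← Matrix.map_mul,
      e₀, e₁, e₀₁']
    simp only [Matrix.map_zero _ (map_zero C), smul_zero, zero_add, add_zero]
    rw [Matrix.map_neg _ (map_neg C), smul_neg, smul_neg, smul_comm, neg_add_cancel]
  have hK := Matrix.rank_add_rank_le_card_of_mul_eq_zero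
    (A := (pencil a₀ a₁).map (algebraMap k[X] (FractionRing k[X])))
    (B := (pencil β₀ β₁).map (algebraMap k[X] (FractionRing k[X])))
    (by rw [← Matrix.map_mul, hmul, Matrix.map_zero _ (map_zero _)])
  rw [Fintype.card_fin] at hK
  -- The generic ranks are bounded below at different parameters: the first map at `1`, the second
  -- at `0`.
  have hA := Matrix.rank_map_eval_le (pencil a₀ a₁) 1
  have hB := Matrix.rank_map_eval_le (pencil β₀ β₁) 0
  rw [hp1, Matrix.rank_eq_finrank_range_toLin _ b₃ b₂, Matrix.toLin_toMatrix] at hA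
  rw [hp0, Matrix.rank_eq_finrank_range_toLin _ b₂ b₁, Matrix.toLin_toMatrix] at hB
  omega

end LinearAlgebra

/-! ### Coefficients of `(1 + t + ⋯ + t^(d-1))^n` -/

section Counting

/-- The coefficient of `t ^ i` in `(1 + t + ⋯ + t ^ (d - 1)) ^ n`, for an integer `i`. -/
def boxCoeff (d : ℕ) : ℕ → ℤ → ℤ
  | 0, i => if i = 0 then 1 else 0
  | n + 1, i => ∑ a ∈ Finset.range d, boxCoeff d n (i - a)

theorem boxCoeff_zero (d : ℕ) (i : ℤ) : boxCoeff d 0 i = if i = 0 then 1 else 0 := rfl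

theorem boxCoeff_succ (d n : ℕ) (i : ℤ) :
    boxCoeff d (n + 1) i = ∑ a ∈ Finset.range d, boxCoeff d n (i - a) := rfl

theorem boxCoeff_of_neg (d n : ℕ) {i : ℤ} (hi : i < 0) : boxCoeff d n i = 0 := by
  induction n generalizing i with
  | zero => rw [boxCoeff_zero, if_neg hi.ne]
  | succ n ih => exact Finset.sum_eq_zero fun a _ => ih (by omega)

theorem boxCoeff_symm (d n : ℕ) (i : ℤ) : boxCoeff d n (n * (d - 1) - i) = boxCoeff d n i := by
  induction n generalizing i with
  | zero => simp [boxCoeff_zero]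
  | succ n ih =>
    rw [boxCoeff_succ, boxCoeff_succ, ← Finset.sum_range_reflect]
    refine Finset.sum_congr rfl fun a ha => ?_
    rw [Finset.mem_range] at ha
    rw [← ih (i - a)]
    congr 1
    have : ((d - 1 - a : ℕ) : ℤ) = d - 1 - a := by omega
    rw [this]
    push_cast
    ring

/-- Multiplying by `1 - t` turns the factor `1 + ⋯ + t^(d-1)` into `1 - t^d`. -/
theorem boxCoeff_succ_sub (d n : ℕ) (i : ℤ) :
    boxCoeff d (n + 1) i - boxCoeff d (n + 1) (i - 1) = boxCoeff d n i - boxCoeff d n (i - d) := by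
  have h := Finset.sum_range_sub (fun a : ℕ => boxCoeff d n (i - a)) d
  rw [boxCoeff_succ, boxCoeff_succ, ← Finset.sum_sub_distrib, ← neg_inj, ← Finset.sum_neg_distrib,
    neg_sub]
  rw [Nat.cast_zero, sub_zero] at h
  rw [← h]
  refine Finset.sum_congr rfl fun a _ => ?_
  rw [neg_sub]
  congr 2
  push_cast
  ring

/-- By induction on the number of factors: the inequality for `n + 1` factors is exactly strict
growth up to the middle for `n + 2` factors, by `boxCoeff_succ_sub`. Growth and symmetry then give
the inequality for `n + 2`. At least one factor is needed for strictness. -/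
theorem boxCoeff_sub_lt (d n : ℕ) (hd : 1 ≤ d) {i : ℤ} (hi : 0 ≤ i)
    (h : 2 * i - d < (n + 1) * (d - 1)) : boxCoeff d (n + 1) (i - d) < boxCoeff d (n + 1) i := by
  induction n generalizing i with
  | zero =>
    push_cast at h
    rw [boxCoeff_of_neg d _ (by omega : i - d < 0), boxCoeff_succ]
    refine Finset.sum_pos' (fun a _ => by rw [boxCoeff_zero]; split_ifs <;> norm_num)
      ⟨i.toNat, Finset.mem_range.2 (by omega), ?_⟩
    rw [boxCoeff_zero, if_pos (by omega)]
    norm_num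
  | succ n ih =>
    set N : ℤ := (n + 2) * (d - 1) with hN
    have hN' : ((n + 1 : ℕ) + 1 : ℤ) * (d - 1) = N := by rw [hN]; push_cast; ring
    have hNd : (n + 1 : ℤ) * (d - 1) = N - (d - 1) := by rw [hN]; ring
    have hN1 : (d : ℤ) - 1 ≤ N := by
      rw [hN]; nlinarith [(by omega : (0 : ℤ) ≤ d - 1), (by omega : (0 : ℤ) ≤ n)]
    have hstep : ∀ j : ℤ, 0 ≤ j → 2 * j ≤ N →
        boxCoeff d (n + 2) (j - 1) < boxCoeff d (n + 2) j := by
      intro j hj hj2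
      have h1 := boxCoeff_succ_sub d (n + 1) j
      have h2 := ih hj (by omega)
      rw [show n + 2 = n + 1 + 1 from rfl]
      omega
    have hmono : ∀ (m : ℕ) (a : ℤ), -1 ≤ a → 2 * (a + m + 1) ≤ N →
        boxCoeff d (n + 2) a < boxCoeff d (n + 2) (a + m + 1) := by
      intro m
      induction m with
      | zero =>
        intro a ha h
        have := hstep (a + 1) (by omega) (by push_cast at h; omega)
        simpa using this
      | succ m ihm =>
        intro a ha h
        have h1 := ihm a ha (by push_cast at h ⊢; omega)
        have h2 := hstep (a + (m + 1 : ℕ) + 1) (by omega) h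
        rw [show a + (m + 1 : ℕ) + 1 - 1 = a + m + 1 by push_cast; ring] at h2
        exact h1.trans h2
    have hlt : ∀ a b : ℤ, a < b → 0 ≤ b → 2 * b ≤ N →
        boxCoeff d (n + 2) a < boxCoeff d (n + 2) b := by
      intro a b hab hb hbN
      rcases lt_or_ge a 0 with ha | ha
      · rw [boxCoeff_of_neg d _ ha, ← boxCoeff_of_neg d (n + 2) (by norm_num : (-1 : ℤ) < 0)]
        have := hmono b.toNat (-1) le_rfl (by omega)
        rwa [show (-1 : ℤ) + b.toNat + 1 = b by omega] at this
      · have := hmono (b - a - 1).toNat a (by omega) (by omega)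
        rwa [show a + (b - a - 1).toNat + 1 = b by omega] at this
    rw [hN'] at h
    -- Past the middle, reflect `i` to `N - i`, which still exceeds `i - d`.
    rcases le_or_gt (2 * i) N with h2 | h2
    · exact hlt _ _ (by omega) hi h2
    · have hs := boxCoeff_symm d (n + 2) i
      rw [show (((n + 2 : ℕ) : ℤ) * (d - 1) - i) = N - i by rw [hN]; push_cast; ring] at hs
      rw [show n + 1 + 1 = n + 2 from rfl, ← hs]
      exact hlt _ _ (by omega) (by omega) (by omega)

/-- `boxCoeff d n i` counts the vectors of length `n` with entries below `d` and sum `i`. -/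
theorem card_box_eq_boxCoeff (d n : ℕ) (i : ℤ) :
    ((Finset.univ.filter fun a : Fin n → Fin d => ((∑ j, (a j : ℕ) : ℕ) : ℤ) = i).card : ℤ) =
      boxCoeff d n i := by
  induction n generalizing i with
  | zero =>
    rw [boxCoeff_zero]
    by_cases h : i = 0
    · simp [h]
    · simp [h, Ne.symm h]
  | succ n ih =>
    rw [boxCoeff_succ, Finset.sum_range fun a => boxCoeff d n (i - a)]
    simp_rw [← ih]
    rw [Finset.card_filter, ← (Fin.consEquiv fun _ => Fin d).sum_comp, Fintype.sum_prod_type,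
      Nat.cast_sum]
    refine Finset.sum_congr rfl fun x _ => ?_
    rw [Finset.card_filter]
    congr 1
    refine Finset.sum_congr rfl fun a _ => ?_
    simp only [Fin.consEquiv_apply, Fin.sum_univ_succ, Fin.cons_zero, Fin.cons_succ]
    congr 1
    push_cast
    exact propext ⟨fun h => by omega, fun h => by omega⟩

end Counting

/-! ### Graded pieces with a degree shift -/

section ShiftedForms

open MvPolynomial

/-- The forms of degree `i - e` in `n` variables; there are only zero ones if `i < e`. -/
noncomputable def shiftedForms (k : Type*) [CommSemiring k] (n e i : ℕ) : Submodule k (MvPolynomial (Fin n) k) :=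
  restrictSupport k {α | α.degree + e = i}

theorem mem_shiftedForms {k : Type*} [CommSemiring k] {n e i : ℕ} {p : MvPolynomial (Fin n) k} :
    p ∈ shiftedForms k n e i ↔ ∀ α, coeff α p ≠ 0 → α.degree + e = i := by
  simp only [shiftedForms, mem_restrictSupport_iff, Set.subset_def, Finset.mem_coe, mem_support_iff,
    Set.mem_ofPred_eq]

theorem mem_shiftedForms_zero {k : Type*} [CommSemiring k] {n i : ℕ}
    {p : MvPolynomial (Fin n) k} : p ∈ shiftedForms k n 0 i ↔ p.IsHomogeneous i := by
  rw [mem_shiftedForms]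
  refine ⟨fun h => fun α hα => ?_, fun h α hα => ?_⟩
  · have := h α hα
    rw [add_zero, Finsupp.degree_eq_weight_one] at this
    exact this
  · rw [add_zero]
    by_contra h'
    exact hα (h.coeff_eq_zero h')

theorem isHomogeneous_of_mem_shiftedForms {k : Type*} [CommSemiring k] {n e i : ℕ}
    {p : MvPolynomial (Fin n) k} (hp : p ∈ shiftedForms k n e i) : p.IsHomogeneous (i - e) :=
  mem_shiftedForms_zero.1 <| mem_shiftedForms.2 fun α hα => by
    have := mem_shiftedForms.1 hp α hα
    omega

theorem mul_mem_shiftedForms {k : Type*} [CommSemiring k] {n d e e' i : ℕ}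
    {f p : MvPolynomial (Fin n) k} (hf : f.IsHomogeneous d) (he : e' = e + d)
    (hp : p ∈ shiftedForms k n e' i) : f * p ∈ shiftedForms k n e i := by
  classical
  rw [mem_shiftedForms] at hp ⊢
  intro α hα
  obtain ⟨β, hβ, γ, hγ, rfl⟩ := Finset.mem_add.1 (support_mul f p (mem_support_iff.2 hα))
  have h₁ := mem_shiftedForms.1 (mem_shiftedForms_zero.2 hf) β (mem_support_iff.1 hβ)
  have h₂ := hp γ (mem_support_iff.1 hγ)
  rw [map_add]
  omega

instance {n e i : ℕ} : Finite {α : Fin n →₀ ℕ | α.degree + e = i} :=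
  ((Finsupp.finite_of_degree_le (σ := Fin n) i).subset fun α (hα : α.degree + e = i) => by
    show α.degree ≤ i
    omega).to_subtype

instance {k : Type*} [CommRing k] {n e i : ℕ} : Module.Finite k (shiftedForms k n e i) :=
  Module.Finite.of_basis (basisRestrictSupport k {α : Fin n →₀ ℕ | α.degree + e = i})

end ShiftedForms

/-! ### Strong Lefschetz property through `𝔰𝔩₂` -/

section Lefschetz

open MvPolynomial

/-- The operator of `𝔰𝔩₂` on `ℚ[X_1, …, X_n]` that is adjoint to multiplication by `X_1 + ⋯ + X_n`
when `ℚ[X] / (X ^ d)` is regarded as an irreducible representation. -/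
noncomputable def loweringOp (n d : ℕ) : Module.End ℚ (MvPolynomial (Fin n) ℚ) :=
  ∑ j, (((d : ℚ) - 1) • (pderiv j : Derivation ℚ _ _).toLinearMap -
    LinearMap.mulLeft ℚ (X j) ∘ₗ (pderiv j : Derivation ℚ _ _).toLinearMap ∘ₗ
      (pderiv j : Derivation ℚ _ _).toLinearMap)

/-- Multiplication by `X_1 + ⋯ + X_n`. -/
noncomputable def raisingOp (n : ℕ) : Module.End ℚ (MvPolynomial (Fin n) ℚ) :=
  LinearMap.mulLeft ℚ (∑ j, X j)

theorem raisingOp_apply {n : ℕ} (p : MvPolynomial (Fin n) ℚ) :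
    raisingOp n p = (∑ j, X j) * p := rfl

theorem raisingOp_pow_apply {n : ℕ} (m : ℕ) (p : MvPolynomial (Fin n) ℚ) :
    (raisingOp n ^ m) p = (∑ j, X j) ^ m * p := by
  rw [raisingOp, LinearMap.pow_mulLeft, LinearMap.mulLeft_apply]

theorem loweringOp_apply {n d : ℕ} (p : MvPolynomial (Fin n) ℚ) :
    loweringOp n d p =
      ∑ j, (((d : ℚ) - 1) • pderiv j p - X j * pderiv j (pderiv j p)) := by
  simp [loweringOp, LinearMap.sum_apply]

theorem coeff_loweringOp {n d : ℕ} (p : MvPolynomial (Fin n) ℚ) (α : Fin n →₀ ℕ) :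
    coeff α (loweringOp n d p) =
      ∑ j, ((α j : ℚ) + 1) * ((d : ℚ) - 1 - α j) * coeff (α + Finsupp.single j 1) p := by
  rw [loweringOp_apply, coeff_sum]
  refine Finset.sum_congr rfl fun j _ => ?_
  rw [coeff_sub, coeff_smul, coeff_X_mul', coeff_pderiv, smul_eq_mul]
  split_ifs with h
  · have h0 : 1 ≤ α j := Nat.one_le_iff_ne_zero.2 (Finsupp.mem_support_iff.1 h)
    have h1 : α - Finsupp.single j 1 + Finsupp.single j 1 = α :=
      tsub_add_cancel_of_le (Finsupp.single_le_iff.2 h0)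
    rw [coeff_pderiv, h1, coeff_pderiv]
    simp only [Finsupp.coe_tsub, Pi.sub_apply, Finsupp.single_eq_same]
    push_cast [h0]
    ring
  · rw [Finsupp.notMem_support_iff.1 h]
    push_cast
    ring

theorem loweringOp_mem {n d e i : ℕ} {p : MvPolynomial (Fin n) ℚ}
    (hp : p ∈ shiftedForms ℚ n e i) : loweringOp n d p ∈ shiftedForms ℚ n (e + 1) i := by
  rw [mem_shiftedForms] at hp ⊢
  intro α hα
  rw [coeff_loweringOp] at hα
  obtain ⟨j, -, hj⟩ := Finset.exists_ne_zero_of_sum_ne_zero hα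
  have := hp _ (right_ne_zero_of_mul hj)
  rw [map_add, Finsupp.degree_single] at this
  omega

theorem loweringOp_pow_mem {n d i : ℕ} {p : MvPolynomial (Fin n) ℚ}
    (hp : p ∈ shiftedForms ℚ n 0 i) (m : ℕ) :
    (loweringOp n d ^ m) p ∈ shiftedForms ℚ n m i := by
  induction m with
  | zero => simpa using hp
  | succ m ih =>
    rw [pow_succ', Module.End.mul_apply]
    exact loweringOp_mem ih

theorem isHomogeneous_sum_X (k : Type*) [CommSemiring k] (n : ℕ) :
    (∑ j, X j : MvPolynomial (Fin n) k).IsHomogeneous 1 :=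
  IsHomogeneous.sum _ _ _ fun j _ => isHomogeneous_X k j

/-- The commutator is a scalar on each degree: every variable contributes `2 X_j ∂_j - (d - 1)`, and
Euler's identity sums these. -/
theorem raisingOp_loweringOp {n d e i : ℕ} {p : MvPolynomial (Fin n) ℚ}
    (hp : p ∈ shiftedForms ℚ n e i) :
    raisingOp n (loweringOp n d p) = loweringOp n d (raisingOp n p) +
      (2 * ((i : ℚ) - e) - n * (d - 1)) • p := by
  have hE : ∑ j, X j * pderiv j p = ((i : ℚ) - e) • p := by
    rcases eq_or_ne p 0 with rfl | h0
    · simp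
    · obtain ⟨α, hα⟩ := ne_zero_iff.1 h0
      have hie := mem_shiftedForms.1 hp α hα
      rw [(isHomogeneous_of_mem_shiftedForms hp).sum_X_mul_pderiv, ← Nat.cast_smul_eq_nsmul ℚ]
      congr 1
      rw [← hie]
      push_cast [Nat.add_sub_cancel]
      ring
  have hD : ∀ j, pderiv j (∑ l, X l : MvPolynomial (Fin n) ℚ) = 1 := by
    intro j
    rw [map_sum]
    simp [pderiv_X, Pi.single_apply]
  have hterm : ∀ j, ((d : ℚ) - 1) • pderiv j ((∑ l, X l) * p) -
      X j * pderiv j (pderiv j ((∑ l, X l) * p)) =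
      (∑ l, X l) * (((d : ℚ) - 1) • pderiv j p - X j * pderiv j (pderiv j p)) +
        (((d : ℚ) - 1) • p - (2 : ℚ) • (X j * pderiv j p)) := by
    intro j
    simp only [pderiv_mul, hD, map_add, one_mul, smul_eq_C_mul]
    rw [show C (2 : ℚ) = (2 : MvPolynomial (Fin n) ℚ) from rfl]
    ring
  rw [raisingOp_apply, raisingOp_apply, loweringOp_apply, loweringOp_apply,
    Finset.sum_congr rfl fun j _ => hterm j, Finset.sum_add_distrib, ← Finset.mul_sum, add_assoc,
    left_eq_add, Finset.sum_sub_distrib, Finset.sum_const, ← Finset.smul_sum, hE, Finset.card_univ,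
    Fintype.card_fin, ← Nat.cast_smul_eq_nsmul ℚ, smul_smul, smul_smul, ← sub_smul, ← add_smul]
  ring_nf
  simp

theorem raisingOp_loweringOp_pow {n d i : ℕ} {p : MvPolynomial (Fin n) ℚ}
    (hp : p ∈ shiftedForms ℚ n 0 i) (m : ℕ) :
    raisingOp n ((loweringOp n d ^ (m + 1)) p) = (loweringOp n d ^ m)
      (loweringOp n d (raisingOp n p) + (((m : ℚ) + 1) * (2 * i - n * (d - 1) - m)) • p) := by
  induction m with
  | zero =>
    rw [zero_add, pow_one, pow_zero, Module.End.one_apply, raisingOp_loweringOp hp]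
    push_cast
    ring_nf
  | succ m ih =>
    rw [pow_succ', Module.End.mul_apply, raisingOp_loweringOp (loweringOp_pow_mem hp (m + 1)), ih,
      ← Module.End.mul_apply, ← pow_succ', map_add, map_add, add_assoc, map_smul, map_smul,
      ← add_smul]
    push_cast
    ring_nf

/-- The squared length of the monomial `X ^ α`. -/
noncomputable def monomialWeight {n : ℕ} (d : ℕ) (α : Fin n →₀ ℕ) : ℚ :=
  ∏ j, (((α j).factorial * (d - 1).descFactorial (α j) : ℕ) : ℚ)

theorem monomialWeight_nonneg {n : ℕ} (d : ℕ) (α : Fin n →₀ ℕ) : 0 ≤ monomialWeight d α :=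
  Finset.prod_nonneg fun _ _ => Nat.cast_nonneg _

theorem monomialWeight_eq_zero_iff {n d : ℕ} (hd : 1 ≤ d) {α : Fin n →₀ ℕ} :
    monomialWeight d α = 0 ↔ ∃ j, d ≤ α j := by
  rw [monomialWeight, Finset.prod_eq_zero_iff]
  refine exists_congr fun j => ?_
  rw [Nat.cast_eq_zero, mul_eq_zero, Nat.descFactorial_eq_zero_iff_lt]
  simp only [Finset.mem_univ, true_and, Nat.factorial_ne_zero, false_or]
  omega

theorem monomialWeight_add_single {n d : ℕ} (hd : 1 ≤ d) (α : Fin n →₀ ℕ) (j : Fin n) :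
    monomialWeight d (α + Finsupp.single j 1) =
      ((α j : ℚ) + 1) * ((d : ℚ) - 1 - α j) * monomialWeight d α := by
  rw [monomialWeight, monomialWeight, ← Finset.mul_prod_erase _ _ (Finset.mem_univ j),
    ← Finset.mul_prod_erase (Finset.univ) (fun l => (((α l).factorial *
      (d - 1).descFactorial (α l) : ℕ) : ℚ)) (Finset.mem_univ j), ← mul_assoc]
  congr 1
  · rw [Finsupp.add_apply, Finsupp.single_eq_same, Nat.factorial_succ, Nat.descFactorial_succ]
    rcases le_or_gt (α j) (d - 1) with h | h
    · push_cast [h, hd]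
      ring
    · rw [Nat.descFactorial_of_lt h]
      simp
  · refine Finset.prod_congr rfl fun l hl => ?_
    rw [Finsupp.add_apply, Finsupp.single_eq_of_ne (Finset.ne_of_mem_erase hl), add_zero]

/-- The positive semidefinite form for which monomials are orthogonal. -/
noncomputable def monomialForm (n d : ℕ) :
    MvPolynomial (Fin n) ℚ →ₗ[ℚ] MvPolynomial (Fin n) ℚ →ₗ[ℚ] ℚ :=
  (basisMonomials (Fin n) ℚ).constr ℚ fun α => monomialWeight d α • lcoeff ℚ α

theorem monomialForm_monomial {n d : ℕ} (α : Fin n →₀ ℕ) (q : MvPolynomial (Fin n) ℚ) :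
    monomialForm n d (monomial α 1) q = monomialWeight d α * coeff α q := by
  have h := (basisMonomials (Fin n) ℚ).constr_basis ℚ
    (fun α => monomialWeight d α • (lcoeff ℚ α : MvPolynomial (Fin n) ℚ →ₗ[ℚ] ℚ)) α
  rw [coe_basisMonomials] at h
  rw [monomialForm, h]
  rfl

theorem monomialForm_apply {n d : ℕ} (p q : MvPolynomial (Fin n) ℚ) :
    monomialForm n d p q =
      ∑ α ∈ p.support, coeff α p * (monomialWeight d α * coeff α q) := by
  conv_lhs => rw [p.as_sum]
  rw [map_sum, LinearMap.sum_apply]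
  refine Finset.sum_congr rfl fun α _ => ?_
  rw [← mul_one (coeff α p), ← smul_eq_mul, ← smul_monomial, map_smul, LinearMap.smul_apply,
    monomialForm_monomial, smul_eq_mul, smul_eq_mul, mul_one]

theorem monomialForm_comm {n d : ℕ} (p q : MvPolynomial (Fin n) ℚ) :
    monomialForm n d p q = monomialForm n d q p := by
  have : monomialForm n d = (monomialForm n d).flip := by
    refine (basisMonomials (Fin n) ℚ).ext fun α => (basisMonomials (Fin n) ℚ).ext fun β => ?_
    classical
    rw [coe_basisMonomials, LinearMap.flip_apply, monomialForm_monomial, monomialForm_monomial,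
      coeff_monomial, coeff_monomial]
    by_cases h : α = β
    · simp [h]
    · rw [if_neg h, if_neg (Ne.symm h), mul_zero, mul_zero]
  exact LinearMap.congr_fun₂ this p q

/-- The weights are chosen for this adjointness: passing from `α` to `α + e_j` multiplies the weight
by precisely the coefficient occurring in `coeff_loweringOp`. -/
theorem monomialForm_raisingOp {n d : ℕ} (hd : 1 ≤ d) (p q : MvPolynomial (Fin n) ℚ) :
    monomialForm n d (raisingOp n p) q = monomialForm n d p (loweringOp n d q) := by
  have : monomialForm n d ∘ₗ raisingOp n = (monomialForm n d).compl₂ (loweringOp n d) := by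
    refine (basisMonomials (Fin n) ℚ).ext fun α => LinearMap.ext fun q => ?_
    rw [coe_basisMonomials, LinearMap.comp_apply, LinearMap.compl₂_apply, monomialForm_monomial,
      coeff_loweringOp, raisingOp_apply, Finset.sum_mul, map_sum, LinearMap.sum_apply,
      Finset.mul_sum]
    refine Finset.sum_congr rfl fun j _ => ?_
    rw [X, monomial_mul, one_mul, add_comm, monomialForm_monomial, monomialWeight_add_single hd]
    ring
  exact LinearMap.congr_fun₂ this p q

theorem monomialForm_self_nonneg {n d : ℕ} (p : MvPolynomial (Fin n) ℚ) :
    0 ≤ monomialForm n d p p := by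
  rw [monomialForm_apply]
  refine Finset.sum_nonneg fun α _ => ?_
  nlinarith [mul_nonneg (monomialWeight_nonneg d α) (mul_self_nonneg (coeff α p))]

theorem exists_le_of_monomialForm_self {n d : ℕ} (hd : 1 ≤ d) {p : MvPolynomial (Fin n) ℚ}
    (hp : monomialForm n d p p = 0) {α : Fin n →₀ ℕ} (hα : α ∈ p.support) : ∃ j, d ≤ α j := by
  rw [monomialForm_apply, Finset.sum_eq_zero_iff_of_nonneg fun α _ => by
    nlinarith [mul_nonneg (monomialWeight_nonneg d α) (mul_self_nonneg (coeff α p))]] at hp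
  rw [← monomialWeight_eq_zero_iff hd]
  have := hp α hα
  rw [mem_support_iff] at hα
  simpa [hα] using this

/-- The radical of the form consists of the polynomials all of whose monomials have an exponent at
least `d`, that is, of the ideal `(X_1^d, …, X_n^d)`. Working modulo it amounts to working in `A`.
-/
theorem mem_ker_monomialForm_iff {n d : ℕ} (hd : 1 ≤ d) {p : MvPolynomial (Fin n) ℚ} :
    p ∈ LinearMap.ker (monomialForm n d) ↔ monomialForm n d p p = 0 := by
  refine ⟨fun h => by rw [LinearMap.mem_ker.1 h, LinearMap.zero_apply], fun h => ?_⟩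
  rw [LinearMap.mem_ker]
  refine LinearMap.ext fun q => ?_
  rw [monomialForm_apply, LinearMap.zero_apply]
  refine Finset.sum_eq_zero fun α hα => ?_
  rw [(monomialWeight_eq_zero_iff hd).2 (exists_le_of_monomialForm_self hd h hα), zero_mul,
    mul_zero]

theorem raisingOp_mem_ker {n d : ℕ} (hd : 1 ≤ d) {p : MvPolynomial (Fin n) ℚ}
    (hp : p ∈ LinearMap.ker (monomialForm n d)) :
    raisingOp n p ∈ LinearMap.ker (monomialForm n d) := by
  rw [LinearMap.mem_ker] at hp ⊢
  refine LinearMap.ext fun q => ?_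
  rw [monomialForm_raisingOp hd, hp]
  rfl

theorem loweringOp_mem_ker {n d : ℕ} (hd : 1 ≤ d) {p : MvPolynomial (Fin n) ℚ}
    (hp : p ∈ LinearMap.ker (monomialForm n d)) :
    loweringOp n d p ∈ LinearMap.ker (monomialForm n d) := by
  rw [LinearMap.mem_ker] at hp ⊢
  refine LinearMap.ext fun q => ?_
  rw [monomialForm_comm, ← monomialForm_raisingOp hd, monomialForm_comm, hp]
  rfl

/-- Write `e`, `f` for raising and lowering. One commutation turns `e^(m+1) f^(m+1) p` into `e^m f^m
(f e p + c p)` with `c > 0`. By induction `f e p + c p` is in the radical; pairing with `p` gives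
`|e p|² + c |p|² = 0`, so `|p|² = 0`. -/
theorem mem_ker_of_raisingOp_pow_loweringOp_pow {n d i m : ℕ} (hd : 1 ≤ d)
    (hm : (m : ℚ) ≤ 2 * i - n * (d - 1)) {p : MvPolynomial (Fin n) ℚ}
    (hp : p ∈ shiftedForms ℚ n 0 i)
    (h : (raisingOp n ^ m) ((loweringOp n d ^ m) p) ∈ LinearMap.ker (monomialForm n d)) :
    p ∈ LinearMap.ker (monomialForm n d) := by
  induction m generalizing p with
  | zero => simpa using h
  | succ m ih =>
    push_cast at hm
    rw [pow_succ, Module.End.mul_apply, raisingOp_loweringOp_pow hp] at h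
    have hfe : loweringOp n d (raisingOp n p) ∈ shiftedForms ℚ n 0 i := by
      have h1 : raisingOp n p ∈ shiftedForms ℚ n 0 (i + 1) :=
        mem_shiftedForms_zero.2 <| by
          rw [add_comm]
          exact (isHomogeneous_sum_X ℚ n).mul (mem_shiftedForms_zero.1 hp)
      have h2 := loweringOp_mem (d := d) h1
      rw [mem_shiftedForms] at h2 ⊢
      exact fun α hα => by have := h2 α hα; omega
    have h' := ih (by linarith) (add_mem hfe (Submodule.smul_mem _ _ hp)) h
    have h0 : monomialForm n d p (loweringOp n d (raisingOp n p) +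
        (((m : ℚ) + 1) * (2 * i - n * (d - 1) - m)) • p) = 0 := by
      rw [monomialForm_comm, LinearMap.mem_ker.1 h', LinearMap.zero_apply]
    rw [map_add, map_smul, ← monomialForm_raisingOp hd, smul_eq_mul] at h0
    have hpos : 0 < ((m : ℚ) + 1) * (2 * i - n * (d - 1) - m) :=
      mul_pos (by positivity) (by linarith)
    have h1 := monomialForm_self_nonneg (d := d) (raisingOp n p)
    have h2 := monomialForm_self_nonneg (d := d) p
    rw [mem_ker_monomialForm_iff hd]
    refine le_antisymm ?_ h2
    by_contra hlt
    rw [not_le] at hlt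
    have := mul_pos hpos hlt
    linarith

/-- Strong Lefschetz property of monomial complete intersections, in the degrees where
multiplication by a power of the sum of the variables is surjective. -/
theorem mem_span_sum_X_pow_X_pow {n d i : ℕ} (hd : 1 ≤ d) (hi : (d : ℚ) ≤ 2 * i - n * (d - 1))
    {p : MvPolynomial (Fin n) ℚ} (hp : p.IsHomogeneous i) :
    p ∈ Ideal.span (Set.range
      (Fin.cons ((∑ j, X j) ^ d) (fun j => X j ^ d) : Fin (n + 1) → MvPolynomial (Fin n) ℚ)) := by
  set I := Ideal.span (Set.range
      (Fin.cons ((∑ j, X j) ^ d) (fun j => X j ^ d) : Fin (n + 1) → MvPolynomial (Fin n) ℚ)) with hI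
  let V := shiftedForms ℚ n 0 i
  let W := LinearMap.ker (monomialForm n d)
  have hTV : ∀ v ∈ V, (raisingOp n ^ d * loweringOp n d ^ d) v ∈ V := by
    intro v hv
    rw [Module.End.mul_apply, raisingOp_pow_apply]
    refine mul_mem_shiftedForms (d := d) ?_ (zero_add d).symm (loweringOp_pow_mem hv d)
    simpa using (isHomogeneous_sum_X ℚ n).pow d
  let T : V →ₗ[ℚ] V := (raisingOp n ^ d * loweringOp n d ^ d).restrict hTV
  let W' : Submodule ℚ V := W.comap V.subtype
  have hpow : ∀ (g : Module.End ℚ (MvPolynomial (Fin n) ℚ)), (∀ v ∈ W, g v ∈ W) →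
      ∀ m : ℕ, ∀ v ∈ W, (g ^ m) v ∈ W := by
    intro g hg m
    induction m with
    | zero => intro v hv; simpa using hv
    | succ m ih => intro v hv; rw [pow_succ', Module.End.mul_apply]; exact hg _ (ih v hv)
  have hTW : W' ≤ W'.comap T := by
    intro v hv
    exact hpow _ (fun v hv => raisingOp_mem_ker hd hv) d _
      (hpow _ (fun v hv => loweringOp_mem_ker hd hv) d _ hv)
  -- On the finite-dimensional quotient of the degree `i` forms by the radical, `e^d f^d` is
  -- injective, hence surjective; so every form is a multiple of `(∑ X_j)^d` modulo the radical.
  have hker : LinearMap.ker (W'.mapQ W' T hTW) = ⊥ := by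
    rw [LinearMap.ker_eq_bot']
    intro v
    induction v using Submodule.Quotient.induction_on with
    | H v =>
      intro hv
      rw [Submodule.mapQ_apply, Submodule.Quotient.mk_eq_zero] at hv
      rw [Submodule.Quotient.mk_eq_zero]
      exact mem_ker_of_raisingOp_pow_loweringOp_pow hd hi v.2 hv
  have hsurj := LinearMap.range_eq_top.1
    ((LinearMap.ker_eq_bot_iff_range_eq_top).1 hker)
  obtain ⟨v, hv⟩ := hsurj (Submodule.Quotient.mk ⟨p, mem_shiftedForms_zero.2 hp⟩)
  obtain ⟨v, rfl⟩ := Submodule.Quotient.mk_surjective _ v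
  rw [Submodule.mapQ_apply, Submodule.Quotient.eq] at hv
  have hW : (raisingOp n ^ d) ((loweringOp n d ^ d) v) - p ∈ W := hv
  have hWI : ∀ q ∈ W, q ∈ I := by
    intro q hq
    rw [mem_ker_monomialForm_iff hd] at hq
    rw [q.as_sum]
    refine I.sum_mem fun α hα => ?_
    obtain ⟨j, hj⟩ := exists_le_of_monomialForm_self hd hq hα
    refine I.mem_of_dvd (a := X j ^ d) ?_ (Ideal.subset_span ⟨j.succ, by rw [Fin.cons_succ]⟩)
    rw [X_pow_eq_monomial, monomial_dvd_monomial]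
    exact ⟨Or.inr (Finsupp.single_le_iff.2 hj), one_dvd _⟩
  have h1 : (raisingOp n ^ d) ((loweringOp n d ^ d) v) ∈ I := by
    rw [raisingOp_pow_apply]
    exact I.mul_mem_right _ (Ideal.subset_span ⟨0, by rw [Fin.cons_zero]⟩)
  have := I.sub_mem h1 (hWI _ hW)
  rwa [sub_sub_cancel] at this

end Lefschetz

/-! ### Koszul relations and the lower bound -/

section Koszul

open MvPolynomial

/-- Multiplication by a form of degree `d`. -/
noncomputable def mulForm {k : Type*} [CommRing k] {n d : ℕ} (e e' i : ℕ) (he : e' = e + d)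
    (f : MvPolynomial (Fin n) k) (hf : f.IsHomogeneous d) :
    shiftedForms k n e' i →ₗ[k] shiftedForms k n e i :=
  (LinearMap.mulLeft k f).restrict fun _ hp => mul_mem_shiftedForms hf he hp

theorem coe_mulForm {k : Type*} [CommRing k] {n d : ℕ} {e e' i : ℕ} (he : e' = e + d)
    {f : MvPolynomial (Fin n) k} (hf : f.IsHomogeneous d) (p : shiftedForms k n e' i) :
    (mulForm e e' i he f hf p : MvPolynomial (Fin n) k) = f * p := rfl

/-- The first differential of the Koszul complex of forms of degree `d`, in degree `i`. -/
noncomputable def koszulOne {k ι : Type*} [CommRing k] [Fintype ι] {n d : ℕ} (i : ℕ)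
    (f : ι → MvPolynomial (Fin n) k) (hf : ∀ j, (f j).IsHomogeneous d) :
    (ι → shiftedForms k n d i) →ₗ[k] shiftedForms k n 0 i :=
  ∑ j, mulForm 0 d i (zero_add d).symm (f j) (hf j) ∘ₗ LinearMap.proj j

/-- The second differential of the Koszul complex of forms of degree `d`, in degree `i`, on
arbitrary (not necessarily alternating) families. -/
noncomputable def koszulTwo {k ι : Type*} [CommRing k] [Fintype ι] {n d : ℕ} (i : ℕ)
    (f : ι → MvPolynomial (Fin n) k) (hf : ∀ j, (f j).IsHomogeneous d) :
    (ι × ι → shiftedForms k n (d + d) i) →ₗ[k] (ι → shiftedForms k n d i) :=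
  LinearMap.pi fun j => ∑ l, mulForm d (d + d) i rfl (f l) (hf l) ∘ₗ
    (LinearMap.proj (R := k) (φ := fun _ : ι × ι => shiftedForms k n (d + d) i) (j, l) -
      LinearMap.proj (l, j))

theorem coe_koszulOne {k ι : Type*} [CommRing k] [Fintype ι] {n d i : ℕ}
    {f : ι → MvPolynomial (Fin n) k} (hf : ∀ j, (f j).IsHomogeneous d)
    (a : ι → shiftedForms k n d i) :
    (koszulOne i f hf a : MvPolynomial (Fin n) k) = ∑ j, f j * a j := by
  simp [koszulOne, LinearMap.sum_apply, coe_mulForm]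

theorem koszulTwo_apply {k ι : Type*} [CommRing k] [Fintype ι] {n d i : ℕ}
    {f : ι → MvPolynomial (Fin n) k} (hf : ∀ j, (f j).IsHomogeneous d)
    (c : ι × ι → shiftedForms k n (d + d) i) (j : ι) :
    koszulTwo i f hf c j = ∑ l, mulForm d (d + d) i rfl (f l) (hf l) (c (j, l) - c (l, j)) := by
  simp [koszulTwo, LinearMap.sum_apply]

theorem coe_koszulOne_koszulTwo {k ι : Type*} [CommRing k] [Fintype ι] {n d i : ℕ}
    {f g : ι → MvPolynomial (Fin n) k} (hf : ∀ j, (f j).IsHomogeneous d)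
    (hg : ∀ j, (g j).IsHomogeneous d) (c : ι × ι → shiftedForms k n (d + d) i) :
    (koszulOne i f hf (koszulTwo i g hg c) : MvPolynomial (Fin n) k) =
      ∑ j, ∑ l, f j * g l * c (j, l) - ∑ j, ∑ l, g j * f l * c (j, l) := by
  rw [coe_koszulOne, Finset.sum_comm (f := fun j l => g j * f l * _), ← Finset.sum_sub_distrib]
  refine Finset.sum_congr rfl fun j _ => ?_
  rw [koszulTwo_apply, AddSubmonoidClass.coe_finsetSum, Finset.mul_sum, ← Finset.sum_sub_distrib]
  refine Finset.sum_congr rfl fun l _ => ?_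
  rw [coe_mulForm, AddSubgroupClass.coe_sub]
  ring

theorem koszulOne_comp_koszulTwo {k ι : Type*} [CommRing k] [Fintype ι] {n d i : ℕ}
    {f : ι → MvPolynomial (Fin n) k} (hf : ∀ j, (f j).IsHomogeneous d) :
    koszulOne i f hf ∘ₗ koszulTwo i f hf = 0 := by
  refine LinearMap.ext fun c => Subtype.ext ?_
  rw [LinearMap.comp_apply, coe_koszulOne_koszulTwo, sub_self]
  rfl

theorem koszulOne_comp_koszulTwo_add {k ι : Type*} [CommRing k] [Fintype ι] {n d i : ℕ}
    {f g : ι → MvPolynomial (Fin n) k} (hf : ∀ j, (f j).IsHomogeneous d)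
    (hg : ∀ j, (g j).IsHomogeneous d) :
    koszulOne i f hf ∘ₗ koszulTwo i g hg + koszulOne i g hg ∘ₗ koszulTwo i f hf = 0 := by
  refine LinearMap.ext fun c => Subtype.ext ?_
  rw [LinearMap.add_apply, LinearMap.comp_apply, LinearMap.comp_apply, AddMemClass.coe_add,
    coe_koszulOne_koszulTwo, coe_koszulOne_koszulTwo, sub_add_sub_cancel, sub_self]
  rfl

theorem koszulTwo_single {k ι : Type*} [CommRing k] [Fintype ι] [DecidableEq ι] {n d i : ℕ}
    {f : ι → MvPolynomial (Fin n) k} (hf : ∀ j, (f j).IsHomogeneous d) (j l : ι)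
    (c : shiftedForms k n (d + d) i) :
    koszulTwo i f hf (Pi.single (j, l) c) =
      Pi.single j (mulForm d (d + d) i rfl (f l) (hf l) c) -
        Pi.single l (mulForm d (d + d) i rfl (f j) (hf j) c) := by
  funext r
  rw [koszulTwo_apply]
  simp only [map_sub, Finset.sum_sub_distrib, Pi.sub_apply]
  congr 1
  · rw [Finset.sum_eq_single l]
    · by_cases h : r = j
      · subst h; simp
      · rw [Pi.single_eq_of_ne h, Pi.single_eq_of_ne (fun h' => h (congrArg Prod.fst h')), map_zero]
    · intro m _ hm
      rw [Pi.single_eq_of_ne (fun h' => hm (congrArg Prod.snd h')), map_zero]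
    · simp
  · rw [Finset.sum_eq_single j]
    · by_cases h : r = l
      · subst h; simp
      · rw [Pi.single_eq_of_ne h, Pi.single_eq_of_ne (fun h' => h (congrArg Prod.snd h')), map_zero]
    · intro m _ hm
      rw [Pi.single_eq_of_ne (fun h' => hm (congrArg Prod.fst h')), map_zero]
    · simp

/-- The forms `0, X_1 ^ d, …, X_n ^ d`. -/
noncomputable def zeroConsPowers (k : Type*) [CommRing k] (n d : ℕ) :
    Fin (n + 1) → MvPolynomial (Fin n) k :=
  Fin.cons 0 fun j => X j ^ d

theorem isHomogeneous_zeroConsPowers (k : Type*) [CommRing k] (n d : ℕ) (j : Fin (n + 1)) :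
    (zeroConsPowers k n d j).IsHomogeneous d := by
  refine Fin.cases ?_ (fun j => ?_) j
  · exact isHomogeneous_zero _ _ _
  · exact isHomogeneous_X_pow j d

/-- Monomial of given degree as an element of the space of shifted forms. -/
noncomputable def shiftedMonomial (k : Type*) [CommRing k] {n e i : ℕ}
    (β : {α : Fin n →₀ ℕ | α.degree + e = i}) : shiftedForms k n e i :=
  ⟨monomial β 1, (monomial_mem_restrictSupport k).2 (Or.inl β.2)⟩

theorem span_range_shiftedMonomial (k : Type*) [CommRing k] (n e i : ℕ) :
    Submodule.span k (Set.range (shiftedMonomial k : {α : Fin n →₀ ℕ | α.degree + e = i} → _)) =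
      ⊤ := by
  refine eq_top_iff.2 fun p _ => ?_
  have hp : p = ∑ α ∈ p.1.support.attach,
      coeff α.1 p.1 • shiftedMonomial k
        ⟨α.1, mem_shiftedForms.1 p.2 α.1 (mem_support_iff.1 α.2)⟩ := by
    refine Subtype.ext ?_
    rw [AddSubmonoidClass.coe_finsetSum]
    conv_lhs => rw [p.1.as_sum, ← Finset.sum_attach]
    refine Finset.sum_congr rfl fun α _ => ?_
    rw [SetLike.val_smul, shiftedMonomial, smul_monomial, smul_eq_mul, mul_one]
  rw [hp]
  exact Submodule.sum_mem _ fun α _ => Submodule.smul_mem _ _ (Submodule.subset_span ⟨_, rfl⟩)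

theorem finrank_shiftedForms (k : Type*) [Field k] (n e i : ℕ) :
    Module.finrank k (shiftedForms k n e i) = {α : Fin n →₀ ℕ | α.degree + e = i}.ncard :=
  (Module.finrank_eq_nat_card_basis (basisRestrictSupport k _)).trans (Nat.card_coe_set_eq _)

/-- Indices of the monomial basis vectors that span a complement of the Koszul relations of
`0, X_1 ^ d, …, X_n ^ d`. -/
def complementIndex (n d i : ℕ) : Set (Fin (n + 1) × {α : Fin n →₀ ℕ | α.degree + d = i}) :=
  {p | (p.1 = 0 → ∀ l, p.2.1 l < d) ∧ ∀ l : Fin n, l.succ < p.1 → p.2.1 l < d}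

/-- The Koszul relations act as rewriting rules. If `X_l^d` divides the monomial in position `j`, it
can be exchanged for a multiple of `g_j` in position `l.succ`. For `j = 0` that is zero, and for
`l.succ < j` the position drops, so induction on `j` terminates. -/
theorem range_koszulTwo_sup_span (k : Type*) [CommRing k] (n d i : ℕ) :
    LinearMap.range (koszulTwo i (zeroConsPowers k n d) (isHomogeneous_zeroConsPowers k n d)) ⊔
      Submodule.span k (Set.range fun p : complementIndex n d i =>
        (Pi.single p.1.1 (shiftedMonomial k p.1.2) : Fin (n + 1) → shiftedForms k n d i)) = ⊤ := by
  set M := LinearMap.range (koszulTwo i (zeroConsPowers k n d)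
    (isHomogeneous_zeroConsPowers k n d)) ⊔
      Submodule.span k (Set.range fun p : complementIndex n d i =>
        (Pi.single p.1.1 (shiftedMonomial k p.1.2) : Fin (n + 1) → shiftedForms k n d i)) with hM
  have hmul : ∀ (l : Fin n) (γ : {α : Fin n →₀ ℕ | α.degree + (d + d) = i})
      (δ : {α : Fin n →₀ ℕ | α.degree + d = i}), δ.1 = γ.1 + Finsupp.single l d →
      mulForm d (d + d) i rfl (zeroConsPowers k n d l.succ)
        (isHomogeneous_zeroConsPowers k n d l.succ) (shiftedMonomial k γ) =
      shiftedMonomial k δ := by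
    intro l γ δ h
    refine Subtype.ext ?_
    rw [coe_mulForm]
    simp only [shiftedMonomial, zeroConsPowers, Fin.cons_succ]
    rw [X_pow_eq_monomial, monomial_mul, one_mul, h, add_comm]
  have hbasis : ∀ (j : Fin (n + 1)) (β : {α : Fin n →₀ ℕ | α.degree + d = i}),
      Pi.single j (shiftedMonomial k β) ∈ M := by
    intro j
    induction j using WellFoundedLT.induction with
    | ind j ih =>
      intro β
      by_cases hβ : (j, β) ∈ complementIndex n d i
      · exact Submodule.mem_sup_right (Submodule.subset_span ⟨⟨(j, β), hβ⟩, rfl⟩)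
      · have hl : ∃ l : Fin n, d ≤ β.1 l ∧ (j = 0 ∨ l.succ < j) := by
          by_contra! hcon
          refine hβ ⟨fun hj l => ?_, fun l hl => ?_⟩
          · by_contra! hle
            exact (hcon l hle).1 hj
          · by_contra! hle
            exact absurd hl (not_lt.2 (hcon l hle).2)
        obtain ⟨l, hl, hj⟩ := hl
        have hsub : β.1 - Finsupp.single l d + Finsupp.single l d = β.1 :=
          tsub_add_cancel_of_le (Finsupp.single_le_iff.2 hl)
        have hdeg : (β.1 - Finsupp.single l d).degree + (d + d) = i := by
          have h1 := congrArg Finsupp.degree hsub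
          have h2 : β.1.degree + d = i := β.2
          rw [map_add, Finsupp.degree_single] at h1
          omega
        have hk := koszulTwo_single (isHomogeneous_zeroConsPowers k n d) j l.succ
          (shiftedMonomial k ⟨_, hdeg⟩)
        rw [hmul l ⟨_, hdeg⟩ β hsub.symm] at hk
        rw [eq_add_of_sub_eq hk.symm]
        refine add_mem (Submodule.mem_sup_left ⟨_, rfl⟩) ?_
        rcases hj with rfl | hj
        · convert zero_mem M
          rw [Pi.single_eq_zero_iff]
          refine Subtype.ext ?_
          rw [coe_mulForm]
          simp [zeroConsPowers]
        · obtain ⟨m, rfl⟩ := Fin.exists_succ_eq.2 (Fin.pos_iff_ne_zero.1 ((Fin.zero_le _).trans_lt hj))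
          have hdeg' : (β.1 - Finsupp.single l d + Finsupp.single m d).degree + d = i := by
            rw [map_add, Finsupp.degree_single]
            omega
          rw [hmul m ⟨_, hdeg⟩ ⟨_, hdeg'⟩ rfl]
          exact ih _ hj _
  refine eq_top_iff.2 fun a _ => ?_
  have ha : a = ∑ j, Pi.single j (a j) := (Finset.univ_sum_single a).symm
  rw [ha]
  refine Submodule.sum_mem _ fun j _ => ?_
  have hle : Submodule.span k (Set.range (shiftedMonomial k :
      {α : Fin n →₀ ℕ | α.degree + d = i} → _)) ≤
      M.comap (LinearMap.single k (fun _ => shiftedForms k n d i) j) := by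
    rw [Submodule.span_le]
    rintro _ ⟨β, rfl⟩
    exact hbasis j β
  rw [span_range_shiftedMonomial] at hle
  exact hle (Submodule.mem_top (x := a j))

/-- The exponent vectors `α` of degree `i - e` with all entries below `d`. -/
def boxExponents (n d e i : ℕ) : Set (Fin n →₀ ℕ) :=
  {α | α.degree + e = i ∧ ∀ j, α j < d}

theorem boxExponents_finite (n d e i : ℕ) : (boxExponents n d e i).Finite :=
  (Set.toFinite {α : Fin n →₀ ℕ | α.degree + e = i}).subset fun _ h => h.1

theorem ncard_boxExponents (n d e i : ℕ) :
    ((boxExponents n d e i).ncard : ℤ) = boxCoeff d n (i - e) := by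
  classical
  rw [← card_box_eq_boxCoeff, Nat.cast_inj, ← Set.ncard_coe_finset]
  refine (Set.ncard_congr (fun a _ => Finsupp.equivFunOnFinite.symm fun j => (a j : ℕ)) ?_ ?_
    ?_).symm
  · intro a ha
    simp only [Finset.coe_filter, Finset.mem_univ, true_and, Set.mem_ofPred_eq] at ha
    refine ⟨?_, fun j => by simp⟩
    rw [Finsupp.degree_eq_sum]
    simp only [Finsupp.equivFunOnFinite_symm_apply_apply]
    omega
  · intro a b _ _ h
    funext j
    have := DFunLike.congr_fun h j
    simpa [Fin.val_inj] using this
  · intro α hα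
    refine ⟨fun j => ⟨α j, hα.2 j⟩, ?_, by ext j; simp⟩
    have h := hα.1
    rw [Finsupp.degree_eq_sum] at h
    simp only [Finset.coe_filter, Finset.mem_univ, true_and, Set.mem_ofPred_eq]
    omega

/-- Position `0` contributes the box monomials of degree `i - d`. A monomial `β` in position
`m.succ` is sent to `X_m^d X^β`, a monomial of degree `i` outside the box; this is injective because
`m` is recovered as the least index with exponent at least `d`. -/
theorem card_complementIndex_le (n d i : ℕ) :
    Nat.card (complementIndex n d i) + (boxExponents n d 0 i).ncard ≤
      (boxExponents n d d i).ncard + {α : Fin n →₀ ℕ | α.degree + 0 = i}.ncard := by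
  classical
  set S : Set (Fin n →₀ ℕ) := {α | α.degree + 0 = i} with hS
  have hSfin : S.Finite := Set.toFinite _
  have hBS : boxExponents n d 0 i ⊆ S := fun _ h => h.1
  rw [← Set.ncard_sdiff_add_ncard_of_subset hBS hSfin, ← add_assoc]
  refine Nat.add_le_add_right ?_ _
  have := (boxExponents_finite n d d i).to_subtype
  have := (hSfin.subset (Set.sdiff_subset (t := boxExponents n d 0 i))).to_subtype
  rw [← Nat.card_coe_set_eq, ← Nat.card_coe_set_eq, ← Nat.card_sum]
  have hz : ∀ p : complementIndex n d i, p.1.1 = 0 → p.1.2.1 ∈ boxExponents n d d i :=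
    fun p hp => ⟨p.1.2.2, p.2.1 hp⟩
  have hs : ∀ (p : complementIndex n d i) (m : Fin n),
      p.1.2.1 + Finsupp.single m d ∈ S \ boxExponents n d 0 i := by
    intro p m
    refine ⟨?_, fun h => ?_⟩
    · have : p.1.2.1.degree + d = i := p.1.2.2
      rw [hS, Set.mem_ofPred_eq, map_add, Finsupp.degree_single]
      omega
    · have := h.2 m
      rw [Finsupp.add_apply, Finsupp.single_eq_same] at this
      omega
  let φ : complementIndex n d i → boxExponents n d d i ⊕ ↥(S \ boxExponents n d 0 i) := fun p =>
    if h : p.1.1 = 0 then Sum.inl ⟨_, hz p h⟩ else Sum.inr ⟨_, hs p (p.1.1.pred h)⟩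
  refine Nat.card_le_card_of_injective φ ?_
  rintro ⟨⟨j, β⟩, hp⟩ ⟨⟨j', β'⟩, hp'⟩ h
  have key : ∀ (m m' : Fin n) (γ γ' : Fin n →₀ ℕ), γ + Finsupp.single m d =
      γ' + Finsupp.single m' d → (∀ l : Fin n, l < m → γ l < d) → ¬ m' < m := by
    intro m m' γ γ' he hl hlt
    have h1 := DFunLike.congr_fun he m'
    rw [Finsupp.add_apply, Finsupp.add_apply, Finsupp.single_eq_same,
      Finsupp.single_eq_of_ne hlt.ne, add_zero] at h1
    have := hl m' hlt
    omega
  refine Fin.cases (motive := fun j => ∀ hp : (j, β) ∈ complementIndex n d i,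
    φ ⟨(j, β), hp⟩ = φ ⟨(j', β'), hp'⟩ → (⟨(j, β), hp⟩ : complementIndex n d i) = _)
    ?_ (fun m => ?_) j hp h <;>
  refine Fin.cases (motive := fun j' => ∀ hp' : (j', β') ∈ complementIndex n d i, ∀ hp,
    φ ⟨_, hp⟩ = φ ⟨(j', β'), hp'⟩ → (⟨_, hp⟩ : complementIndex n d i) = ⟨(j', β'), hp'⟩)
    ?_ (fun m' => ?_) j' hp'
  · intro hp' hp h
    simp only [φ, dif_pos, Sum.inl.injEq, Subtype.mk.injEq] at h
    exact Subtype.ext (Prod.ext rfl (Subtype.ext h))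
  · intro hp' hp h
    simp [φ] at h
  · intro hp' hp h
    simp [φ] at h
  · intro hp' hp h
    simp only [φ, Fin.succ_ne_zero, dif_neg, not_false_eq_true, Sum.inr.injEq, Subtype.mk.injEq,
      Fin.pred_succ] at h
    have h1 := key m m' _ _ h fun l hl => hp.2 l (Fin.succ_lt_succ_iff.2 hl)
    have h2 := key m' m _ _ h.symm fun l hl => hp'.2 l (Fin.succ_lt_succ_iff.2 hl)
    obtain rfl := le_antisymm (not_lt.1 h1) (not_lt.1 h2)
    exact Subtype.ext (Prod.ext rfl (Subtype.ext (add_right_cancel h)))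

theorem ncard_boxExponents_le_of_surjective {k : Type*} [Field k] {n d i : ℕ}
    {f : Fin (n + 1) → MvPolynomial (Fin n) k} (hf : ∀ j, (f j).IsHomogeneous d)
    (hsurj : Function.Surjective (koszulOne i f hf)) :
    (boxExponents n d 0 i).ncard ≤ (boxExponents n d d i).ncard := by
  have hg := isHomogeneous_zeroConsPowers k n d
  have h1 := finrank_range_add_finrank_range_le (koszulOne i _ hg) (koszulOne i f hf)
    (koszulTwo i _ hg) (koszulTwo i f hf) (koszulOne_comp_koszulTwo hg)
    (koszulOne_comp_koszulTwo hf) (koszulOne_comp_koszulTwo_add hg hf)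
  rw [LinearMap.range_eq_top.2 hsurj, finrank_top, finrank_shiftedForms] at h1
  have h2 := Submodule.finrank_add_le_finrank_add_finrank
    (LinearMap.range (koszulTwo i (zeroConsPowers k n d) hg))
    (Submodule.span k (Set.range fun p : complementIndex n d i =>
        (Pi.single p.1.1 (shiftedMonomial k p.1.2) : Fin (n + 1) → shiftedForms k n d i)))
  rw [range_koszulTwo_sup_span, finrank_top] at h2
  have := Fintype.ofFinite (complementIndex n d i)
  have h3 := finrank_range_le_card (R := k) fun p : complementIndex n d i =>
    (Pi.single p.1.1 (shiftedMonomial k p.1.2) : Fin (n + 1) → shiftedForms k n d i)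
  rw [Set.finrank, ← Nat.card_eq_fintype_card] at h3
  have h4 := card_complementIndex_le n d i
  omega

theorem exists_shiftedForms_of_mem_span {k ι : Type*} [CommRing k] [Fintype ι] {n d i : ℕ}
    {f : ι → MvPolynomial (Fin n) k} (hf : ∀ j, (f j).IsHomogeneous d)
    {p : MvPolynomial (Fin n) k} (hp : p.IsHomogeneous i) (h : p ∈ Ideal.span (Set.range f)) :
    ∃ a : ι → shiftedForms k n d i, ∑ j, f j * a j = p := by
  classical
  obtain ⟨c, hc⟩ := Ideal.mem_span_range_iff_exists_fun.1 h
  have key : ∀ j, ∃ a : shiftedForms k n d i, f j * a = homogeneousComponent i (f j * c j) := by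
    intro j
    -- Keep the part of `c j` of degree `i - d`; the condition `α.degree + d = i` leaves nothing
    -- when `i < d`.
    refine ⟨⟨∑ α ∈ (c j).support with α.degree + d = i, monomial α (coeff α (c j)),
      Submodule.sum_mem _ fun α hα => (monomial_mem_restrictSupport k).2
        (Or.inl (Finset.mem_filter.1 hα).2)⟩, ?_⟩
    conv_rhs => rw [(c j).as_sum]
    rw [Finset.mul_sum, Finset.mul_sum, map_sum, Finset.sum_filter]
    refine Finset.sum_congr rfl fun α _ => ?_
    have := homogeneousComponent_of_mem (m := i)
      ((hf j).mul (isHomogeneous_monomial (coeff α (c j)) (rfl : α.degree = α.degree)))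
    rw [this]
    exact if_congr (by omega) rfl rfl
  choose a ha using key
  refine ⟨a, ?_⟩
  rw [Finset.sum_congr rfl fun j _ => ha j, ← map_sum]
  simp_rw [mul_comm (f _)]
  rw [hc, homogeneousComponent_of_mem hp, if_pos rfl]

/-- The ideal generated by `n + 1` forms of degree `d` in `n` variables does not contain all forms
of degree `i`, provided that `2 * i ≤ (n + 1) * (d - 1)`. -/
theorem exists_isHomogeneous_notMem_span {k : Type*} [Field k] {n d i : ℕ} (hn : 1 ≤ n)
    (hd : 1 ≤ d) (hi : 2 * i ≤ (n + 1) * (d - 1)) {f : Fin (n + 1) → MvPolynomial (Fin n) k}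
    (hf : ∀ j, (f j).IsHomogeneous d) :
    ∃ p : MvPolynomial (Fin n) k, p.IsHomogeneous i ∧ p ∉ Ideal.span (Set.range f) := by
  by_contra! hcon
  have hsurj : Function.Surjective (koszulOne i f hf) := by
    intro p
    have hp := mem_shiftedForms_zero.1 p.2
    obtain ⟨a, ha⟩ := exists_shiftedForms_of_mem_span hf hp (hcon _ hp)
    exact ⟨a, Subtype.ext ((coe_koszulOne hf a).trans ha)⟩
  have h1 := ncard_boxExponents_le_of_surjective hf hsurj
  rw [← Nat.cast_le (α := ℤ), ncard_boxExponents, ncard_boxExponents, Nat.cast_zero, sub_zero] at h1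
  -- In terms of `m`, the bound `2i ≤ (n+1)(d-1)` is `2i - d < (m+1)(d-1)`, since `(n+1)(d-1) =
  -- n(d-1) + d - 1`.
  obtain ⟨m, rfl⟩ : ∃ m, n = m + 1 := ⟨n - 1, by omega⟩
  refine absurd h1 (not_le.2 (boxCoeff_sub_lt d m hd (Nat.cast_nonneg i) ?_))
  zify [hd] at hi
  linarith

end Koszul

/-! ### Openness, the example, and the conclusion -/

section Assembly

open MvPolynomial

theorem quotientComponent_ne_bot_iff {k : Type*} [Field k] {n μ : ℕ}
    {I : Ideal (MvPolynomial (Fin n) k)} :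
    quotientComponent I μ ≠ ⊥ ↔ ∃ p : MvPolynomial (Fin n) k, p.IsHomogeneous μ ∧ p ∉ I := by
  rw [quotientComponent, Submodule.ne_bot_iff]
  constructor
  · rintro ⟨_, ⟨p, hp, rfl⟩, h0⟩
    exact ⟨p, hp, fun hpI => h0 (Ideal.Quotient.eq_zero_iff_mem.2 hpI)⟩
  · rintro ⟨p, hp, hpI⟩
    exact ⟨_, ⟨p, hp, rfl⟩, fun h0 => hpI (Ideal.Quotient.eq_zero_iff_mem.1 h0)⟩

theorem le_gradedEnd {k : Type*} [Field k] {n μ : ℕ} {I : Ideal (MvPolynomial (Fin n) k)}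
    {p : MvPolynomial (Fin n) k} (hp : p.IsHomogeneous μ) (hpI : p ∉ I) :
    ((μ : ℕ∞) : WithBot ℕ∞) ≤ gradedEnd (quotientComponent I) :=
  le_sSup ⟨μ, quotientComponent_ne_bot_iff.2 ⟨p, hp, hpI⟩, rfl⟩

theorem mem_of_isHomogeneous_of_le {k : Type*} [Field k] {n t μ : ℕ}
    {I : Ideal (MvPolynomial (Fin n) k)} (hI : ∀ α : Fin n →₀ ℕ, α.degree = t → monomial α 1 ∈ I)
    (hμ : t ≤ μ) {p : MvPolynomial (Fin n) k} (hp : p.IsHomogeneous μ) : p ∈ I := by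
  rw [p.as_sum]
  refine I.sum_mem fun α hα => ?_
  have hdeg : t ≤ α.degree := by
    have := mem_shiftedForms.1 (mem_shiftedForms_zero.2 hp) α (mem_support_iff.1 hα)
    omega
  obtain ⟨β, hβα, hβ⟩ := α.exists_le_degree_eq t hdeg
  refine I.mem_of_dvd ?_ (hI β hβ)
  rw [monomial_dvd_monomial]
  exact ⟨Or.inr hβα, one_dvd _⟩

theorem gradedEnd_le {k : Type*} [Field k] {n t : ℕ} {I : Ideal (MvPolynomial (Fin n) k)}
    (hI : ∀ α : Fin n →₀ ℕ, α.degree = t + 1 → monomial α 1 ∈ I) :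
    gradedEnd (quotientComponent I) ≤ ((t : ℕ∞) : WithBot ℕ∞) := by
  refine sSup_le ?_
  rintro _ ⟨μ, hμ, rfl⟩
  obtain ⟨p, hp, hpI⟩ := quotientComponent_ne_bot_iff.1 hμ
  refine WithBot.coe_le_coe.2 (Nat.cast_le.2 ?_)
  by_contra! h
  exact hpI (mem_of_isHomogeneous_of_le hI h hp)

theorem idealOfVars_isMaximal (k : Type*) [Field k] (n : ℕ) : (idealOfVars (Fin n) k).IsMaximal := by
  have : idealOfVars (Fin n) k = RingHom.ker (constantCoeff : MvPolynomial (Fin n) k →+* k) := by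
    refine le_antisymm (Ideal.span_le.2 ?_) fun p hp => ?_
    · rintro _ ⟨j, rfl⟩
      exact constantCoeff_X _ _
    · rw [← pow_one (idealOfVars (Fin n) k), mem_pow_idealOfVars_iff]
      intro α hα
      rw [Nat.one_le_iff_ne_zero, Ne, Finsupp.degree_eq_zero_iff]
      rintro rfl
      exact mem_support_iff.1 hα hp
  rw [this]
  exact RingHom.ker_isMaximal_of_surjective _ fun r => ⟨C r, constantCoeff_C _ r⟩

theorem isIrrelevantPrimary_of_monomial_mem {k : Type*} [Field k] {n d t : ℕ} (hd : 1 ≤ d)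
    {f : Fin (n + 1) → MvPolynomial (Fin n) k} (hf : ∀ j, (f j).IsHomogeneous d)
    (hI : ∀ α : Fin n →₀ ℕ, α.degree = t → monomial α 1 ∈ Ideal.span (Set.range f)) :
    IsIrrelevantPrimary (Ideal.span (Set.range f)) := by
  have hmax := idealOfVars_isMaximal k n
  have hrad : (Ideal.span (Set.range f)).radical = idealOfVars (Fin n) k := by
    refine le_antisymm (hmax.isPrime.radical_le_iff.2 (Ideal.span_le.2 ?_)) (Ideal.span_le.2 ?_)
    · rintro _ ⟨j, rfl⟩
      rw [SetLike.mem_coe, ← pow_one (idealOfVars (Fin n) k), mem_pow_idealOfVars_iff]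
      intro α hα
      have := mem_shiftedForms.1 (mem_shiftedForms_zero.2 (hf j)) α (mem_support_iff.1 hα)
      omega
    · rintro _ ⟨j, rfl⟩
      refine ⟨t, ?_⟩
      rw [X_pow_eq_monomial]
      exact hI _ (Finsupp.degree_single _ _)
  exact ⟨Ideal.isPrimary_of_isMaximal_radical (hrad ▸ hmax), hrad⟩

/-- The coefficient of `X ^ β` in `∑ j, q j * f j` as a polynomial in the coefficients of the
forms `f j` of degree `d`. -/
noncomputable def coeffSumPoly {k : Type*} [Field k] {n : ℕ} (d : ℕ) (β : Fin n →₀ ℕ)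
    (q : Fin (n + 1) → MvPolynomial (Fin n) k) : MvPolynomial (FormCoeffIndex n d) k :=
  ∑ j, ∑ x ∈ Finset.HasAntidiagonal.antidiagonal β, C (coeff x.2 (q j)) *
    if h : x.1.degree = d then X (j, ⟨x.1, h⟩) else 0

theorem eval_coeffSumPoly {k : Type*} [Field k] {n d : ℕ} (β : Fin n →₀ ℕ)
    (q : Fin (n + 1) → MvPolynomial (Fin n) k) {f : Fin (n + 1) → MvPolynomial (Fin n) k}
    (hf : ∀ j, (f j).IsHomogeneous d) :
    eval (formCoeffs d f) (coeffSumPoly d β q) = coeff β (∑ j, f j * q j) := by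
  rw [coeffSumPoly, map_sum, coeff_sum]
  refine Finset.sum_congr rfl fun j _ => ?_
  rw [map_sum, coeff_mul]
  refine Finset.sum_congr rfl fun x _ => ?_
  rw [map_mul, eval_C, mul_comm]
  congr 1
  split_ifs with h
  · rw [eval_X]
    rfl
  · rw [map_zero, (hf j).coeff_eq_zero h]

/-- The determinant of the coefficients of the forms `∑ j, q α j * f j`, for `α` in a finite set
of exponent vectors, as a polynomial in the coefficients of the forms `f j` of degree `d`. -/
noncomputable def coeffDet {k : Type*} [Field k] {n : ℕ} (d : ℕ) {T : Type*} [Fintype T] [DecidableEq T]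
    (ε : T → Fin n →₀ ℕ) (q : T → Fin (n + 1) → MvPolynomial (Fin n) k) :
    MvPolynomial (FormCoeffIndex n d) k :=
  (Matrix.of fun α β => coeffSumPoly d (ε β) (q α)).det

theorem eval_coeffDet {k : Type*} [Field k] {n d : ℕ} {T : Type*} [Fintype T] [DecidableEq T]
    (ε : T → Fin n →₀ ℕ) (q : T → Fin (n + 1) → MvPolynomial (Fin n) k)
    {f : Fin (n + 1) → MvPolynomial (Fin n) k} (hf : ∀ j, (f j).IsHomogeneous d) :
    eval (formCoeffs d f) (coeffDet d ε q) =
      (Matrix.of fun α β => coeff (ε β) (∑ j, f j * q α j)).det := by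
  rw [coeffDet, RingHom.map_det]
  congr 1
  ext α β
  exact eval_coeffSumPoly _ _ hf

/-- The tuples of forms of degree `d` that generate an ideal containing all forms of degree `t`. -/
theorem exists_isZariskiOpen_monomial_mem (k : Type*) [Field k] (n d t : ℕ) :
    ∃ U : Set (FormCoeffIndex n d → k), IsZariskiOpen U ∧
      ∀ f : Fin (n + 1) → MvPolynomial (Fin n) k, (∀ j, (f j).IsHomogeneous d) →
        (formCoeffs d f ∈ U ↔
          ∀ α : Fin n →₀ ℕ, α.degree = t → monomial α 1 ∈ Ideal.span (Set.range f)) := by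
  classical
  let T := {α : Fin n →₀ ℕ | α.degree + 0 = t}
  have := Fintype.ofFinite T
  -- A choice `q` of multipliers gives as many elements of `I` of degree `t` as there are monomials;
  -- they span all forms of degree `t` exactly when the determinant is nonzero. The open set is
  -- where some such determinant survives.
  let D : (T → Fin (n + 1) → shiftedForms k n d t) → MvPolynomial (FormCoeffIndex n d) k :=
    fun q => coeffDet d (fun α : T => α.1) fun α j => q α j
  refine ⟨_, ⟨Ideal.span (Set.range D), rfl⟩, fun f hf => ?_⟩
  have hmem : formCoeffs d f ∈ (zeroLocus k (Ideal.span (Set.range D)))ᶜ ↔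
      ∃ q, eval (formCoeffs d f) (D q) ≠ 0 := by
    rw [Set.mem_compl_iff, ← not_forall_not, not_iff_not]
    simp only [not_not]
    refine ⟨fun h q => ?_, fun h p hp => ?_⟩
    · rw [← coe_aeval_eq_eval]
      exact h _ (Ideal.subset_span ⟨q, rfl⟩)
    · have hle : Ideal.span (Set.range D) ≤ RingHom.ker (eval (formCoeffs d f)) := by
        rw [Ideal.span_le]
        rintro _ ⟨q, rfl⟩
        exact h q
      exact hle hp
  rw [hmem]
  constructor
  · rintro ⟨q, hq⟩ α hα
    rw [eval_coeffDet _ _ hf] at hq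
    set N : Matrix T T k := Matrix.of fun α β => coeff β.1 (∑ j, f j * (q α j).1) with hN
    have hinv : N⁻¹ * N = 1 := Matrix.nonsing_inv_mul _ (isUnit_iff_ne_zero.2 hq)
    let α' : T := ⟨α, hα⟩
    have hsum : monomial α (1 : k) = ∑ β, N⁻¹ α' β • ∑ j, f j * (q β j).1 := by
      ext γ
      rw [coeff_sum]
      simp only [coeff_smul, smul_eq_mul]
      by_cases hγ : γ ∈ T
      · have := congrFun (congrFun hinv α') ⟨γ, hγ⟩
        rw [Matrix.mul_apply, Matrix.one_apply] at this
        rw [coeff_monomial]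
        refine Eq.trans ?_ this.symm
        refine if_congr ?_ rfl rfl
        rw [Subtype.mk.injEq]
      · rw [coeff_monomial, if_neg (fun h : α = γ => hγ (h ▸ hα))]
        refine (Finset.sum_eq_zero fun β _ => ?_).symm
        have hhom : (∑ j, f j * (q β j).1) ∈ shiftedForms k n 0 t :=
          Submodule.sum_mem _ fun j _ => mul_mem_shiftedForms (hf j) (zero_add d).symm (q β j).2
        by_contra hne
        exact hγ (mem_shiftedForms.1 hhom γ (right_ne_zero_of_mul hne))
    rw [hsum]
    refine Ideal.sum_mem _ fun β _ => ?_
    rw [smul_eq_C_mul]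
    exact Ideal.mul_mem_left _ _ (Ideal.sum_mem _ fun j _ =>
      Ideal.mul_mem_right _ _ (Ideal.subset_span ⟨j, rfl⟩))
  · intro h
    -- Multipliers that produce the monomials themselves make the coefficient matrix the identity.
    choose q hq using fun α : T =>
      exists_shiftedForms_of_mem_span hf (isHomogeneous_monomial (1 : k) α.2) (h α.1 α.2)
    refine ⟨q, ?_⟩
    rw [eval_coeffDet _ _ hf]
    have : (Matrix.of fun α β : T => coeff β.1 (∑ j, f j * (q α j).1)) = (1 : Matrix T T k) := by
      ext α β
      rw [Matrix.of_apply, hq, coeff_monomial, Matrix.one_apply]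
      exact if_congr Subtype.ext_iff.symm rfl rfl
    rw [this, Matrix.det_one]
    exact one_ne_zero

/-- The forms `(X_1 + ⋯ + X_n) ^ d, X_1 ^ d, …, X_n ^ d`. -/
noncomputable def sumConsPowers (k : Type*) [CommRing k] (n d : ℕ) :
    Fin (n + 1) → MvPolynomial (Fin n) k :=
  Fin.cons ((∑ j, X j) ^ d) fun j => X j ^ d

theorem isHomogeneous_sumConsPowers (k : Type*) [CommRing k] (n d : ℕ) (j : Fin (n + 1)) :
    (sumConsPowers k n d j).IsHomogeneous d := by
  refine Fin.cases ?_ (fun j => ?_) j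
  · simpa [sumConsPowers] using (isHomogeneous_sum_X k n).pow d
  · exact isHomogeneous_X_pow j d

/-- The positivity argument lives over `ℚ`; ideal membership passes to any field of characteristic
zero along `ℚ → k`. The hypothesis on `i` is equivalent to `d ≤ 2i - n(d-1)`. -/
theorem monomial_mem_span_sumConsPowers {k : Type*} [Field k] [CharZero k] {n d i : ℕ}
    (hd : 1 ≤ d) (hi : (n + 1) * (d - 1) < 2 * i) {α : Fin n →₀ ℕ} (hα : α.degree = i) :
    monomial α 1 ∈ Ideal.span (Set.range (sumConsPowers k n d)) := by
  have hi' : (d : ℚ) ≤ 2 * i - n * (d - 1) := by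
    have : (n + 1) * (d - 1) + 1 ≤ 2 * i := hi
    rw [← Nat.cast_le (α := ℚ)] at this
    push_cast [hd] at this
    linarith
  have h := Ideal.mem_map_of_mem (map (Rat.castHom k))
    (mem_span_sum_X_pow_X_pow hd hi' (isHomogeneous_monomial (1 : ℚ) hα))
  rw [map_monomial, map_one, Ideal.map_span, ← Set.range_comp] at h
  convert h using 3
  funext j
  refine Fin.cases ?_ (fun j => ?_) j <;> simp [sumConsPowers]

end Assembly

theorem mainTheorem5 {k : Type*} [Field k] (n d : ℕ) (hn : 2 ≤ n) (hd : 1 ≤ d) :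
    (∀ f : Fin (n + 1) → MvPolynomial (Fin n) k,
      (∀ i, (f i).IsHomogeneous d) →
      IsIrrelevantPrimary (Ideal.span (Set.range f)) →
      ((((n + 1) * (d - 1) / 2 : ℕ) : ℕ∞) : WithBot ℕ∞) ≤
        gradedEnd (quotientComponent (Ideal.span (Set.range f)))) ∧
    (CharZero k →
      ∃ U : Set (FormCoeffIndex n d → k), IsZariskiOpen U ∧ U.Nonempty ∧
        ∀ f : Fin (n + 1) → MvPolynomial (Fin n) k,
          (∀ i, (f i).IsHomogeneous d) →
          formCoeffs d f ∈ U →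
          IsIrrelevantPrimary (Ideal.span (Set.range f)) ∧
          gradedEnd (quotientComponent (Ideal.span (Set.range f))) =
            ((((n + 1) * (d - 1) / 2 : ℕ) : ℕ∞) : WithBot ℕ∞)) := by
  have hlower : ∀ f : Fin (n + 1) → MvPolynomial (Fin n) k, (∀ i, (f i).IsHomogeneous d) →
      ((((n + 1) * (d - 1) / 2 : ℕ) : ℕ∞) : WithBot ℕ∞) ≤
        gradedEnd (quotientComponent (Ideal.span (Set.range f))) := by
    intro f hf
    obtain ⟨p, hp, hpI⟩ := exists_isHomogeneous_notMem_span (by omega : 1 ≤ n) hd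
      (Nat.mul_div_le ((n + 1) * (d - 1)) 2) hf
    exact le_gradedEnd hp hpI
  refine ⟨fun f hf _ => hlower f hf, fun _ => ?_⟩
  -- The degree `⌊(n+1)(d-1)/2⌋ + 1` is the least `t` with `2t > (n+1)(d-1)`. Containing all its
  -- monomials makes `I` `𝔪`-primary and bounds the end from above.
  obtain ⟨U, hU, hmem⟩ := exists_isZariskiOpen_monomial_mem k n d ((n + 1) * (d - 1) / 2 + 1)
  refine ⟨U, hU, ⟨formCoeffs d (sumConsPowers k n d), (hmem _ (isHomogeneous_sumConsPowers k n d)).2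
    fun α hα => monomial_mem_span_sumConsPowers hd (by omega) hα⟩, fun f hf hfU => ?_⟩
  have hI := (hmem f hf).1 hfU
  exact ⟨isIrrelevantPrimary_of_monomial_mem hd hf hI, le_antisymm (gradedEnd_le hI) (hlower f hf)⟩
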